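/- For $n\ge 0$ let $a_{2,7}(n)$ denote the number of partitions of $n$ into pairwise distinct parts none of which is divisible by $2$ or by $7$, and for $k\ge 1$ let $f_k=\prod_{m=1}^{\infty}(1-q^{km})\in\mathbb{Z}[[q]]$. Two power series in $\mathbb{Z}[[q]]$ are called congruent modulo $2$ if their corresponding coefficients are congruent modulo $2$. Let $p>7$ be a prime with Legendre symbol $\left(\frac{-14}{p}\right)=-1$, and let $1\le j\le p-1$. Then for all integers $\alpha\ge 0$, $$\sum_{n=0}^{\infty} a_{2,7}\Big(2p^{2\alpha}n+\frac{5p^{2\alpha}-1}{4}\Big)q^n\equiv f_1f_{14}\pmod 2,$$ $$\sum_{n=0}^{\infty} a_{2,7}\Big(14p^{2\alpha}n+\frac{21p^{2\alpha}-1}{4}\Big)q^n\equiv f_2f_7\pmod 2,$$ and, for all integers $n\ge 0$, $$a_{2,7}\Big(2p^{2\alpha+1}(pn+j)+\frac{5p^{2\alpha+2}-1}{4}\Big)\equiv 0\pmod 2,$$ $$a_{2,7}\Big(14p^{2\alpha+1}(pn+j)+\frac{21p^{2\alpha+2}-1}{4}\Big)\equiv 0\pmod 2.$$ -/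

import Mathlib

namespace RegularDistinct

open scoped PowerSeries.WithPiTopology

/-- The number of `(r, s)`-regular partitions of `n` into distinct parts: partitions of `n` with
pairwise distinct parts, none of which is divisible by `r` or by `s`. -/
def a (r s n : ℕ) : ℕ :=
  ((Nat.Partition.distincts n).filter fun π => ∀ i ∈ π.parts, ¬ r ∣ i ∧ ¬ s ∣ i).card

/-- The formal power series `f_k = (q^k; q^k)_∞ = ∏_{n ≥ 0} (1 - q^k (q^k)^n)` over `ℤ`, for
`k ≥ 1`; the infinite product is taken in the topology of coefficientwise convergence, `ℤ` being
discrete. -/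
noncomputable def f (k : ℕ) : PowerSeries ℤ :=
  ∏' n : ℕ, (1 - PowerSeries.X ^ k * (PowerSeries.X ^ k) ^ n)

/-- The product that defines `f k` converges for `k ≥ 1`. -/
theorem multipliable_f {k : ℕ} (hk : 1 ≤ k) :
    Multipliable fun n : ℕ =>
      (1 - PowerSeries.X ^ k * (PowerSeries.X ^ k) ^ n : PowerSeries ℤ) := by
  simp_rw [sub_eq_add_neg]
  apply PowerSeries.WithPiTopology.multipliable_one_add_of_tendsto_order_atTop_nhds_top
  refine ENat.tendsto_nhds_top_iff_natCast_lt.mpr fun N =>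
    Filter.eventually_atTop.mpr ⟨N, fun m hm => ?_⟩
  rw [← pow_mul, ← pow_add, PowerSeries.order_neg, PowerSeries.order_X_pow]
  have h : N < k + k * m := by nlinarith
  exact_mod_cast h

/-- Two integer power series are congruent modulo `m` if all their coefficients are. -/
def SeriesModEq (m : ℤ) (A B : PowerSeries ℤ) : Prop :=
  ∀ n : ℕ, PowerSeries.coeff n A ≡ PowerSeries.coeff n B [ZMOD m]

end RegularDistinct

namespace RegularDistinct

open scoped PowerSeries.WithPiTopology
open PowerSeries

/-! Modulo 2 signs vanish and `f (2 * k)` is the square of `f k`, so the generating function of `a 2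
7` is `f 1 * f 14 / (f 2 * f 7)`, that is `f 1 * f 7 / f 2`. Since `f 2` is even in `q`, the odd
part of this quotient is determined by that of `f 1 * f 7`.

By the pentagonal number theorem, the coefficient of `q ^ n` in `f a * f b` is, modulo 2, the number
of representations of `24 * n + a + b` by `a x² + b y²` with `x, y` positive and prime to 6.
Arithmetic in `ℚ(√-7)` shows that `4M` and `M = 12 * n + 8` have equally many representations by `x²
+ 7y²` modulo 2 (`card_reps_four_mul_zmod_two`). Hence the odd part of `f 1 * f 7` is `f 2 * f 14`,
and `a 2 7 (2 * m + 1)` has the parity of the number of representations of `24 * m + 15` by `x² +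
14y²` (`a_odd_eq_card_reps`).

As -14 is a non-residue, `p ∣ x² + 14y²` forces `p ∣ x` and `p ∣ y`. So factors `p²` can be removed,
and a number divisible by `p` exactly once has no representation. A factor 7 turns `x² + 14y²` into
`2x² + 7y²`. -/

/-! ### The products `f k` modulo 2 -/

/-- The reduction of `f k` modulo `2`. -/
noncomputable def fmod (k : ℕ) : PowerSeries (ZMod 2) :=
  PowerSeries.map (Int.castRingHom (ZMod 2)) (f k)

theorem continuous_map_castRingHom :
    Continuous
      (PowerSeries.map (Int.castRingHom (ZMod 2)) : PowerSeries ℤ → PowerSeries (ZMod 2)) := by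
  rw [continuous_iff_continuousAt]
  intro g
  rw [ContinuousAt, WithPiTopology.tendsto_iff_coeff_tendsto]
  intro d
  simp only [coeff_map]
  exact (continuous_of_discreteTopology.comp (WithPiTopology.continuous_coeff ℤ d)).tendsto g

theorem continuous_expand {k : ℕ} (hk : k ≠ 0) :
    Continuous (PowerSeries.expand k hk : PowerSeries (ZMod 2) → PowerSeries (ZMod 2)) := by
  rw [continuous_iff_continuousAt]
  intro g
  rw [ContinuousAt, WithPiTopology.tendsto_iff_coeff_tendsto]
  intro d
  simp only [coeff_expand]
  split_ifs
  · exact (WithPiTopology.continuous_coeff (ZMod 2) _).tendsto g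
  · exact tendsto_const_nhds

theorem hasProd_fmod {k : ℕ} (hk : k ≠ 0) :
    HasProd (fun n : ℕ => (1 - X ^ (k * (n + 1)) : PowerSeries (ZMod 2))) (fmod k) := by
  have h := ((multipliable_f (Nat.one_le_iff_ne_zero.mpr hk)).hasProd).map
    (PowerSeries.map (Int.castRingHom (ZMod 2))) continuous_map_castRingHom
  rw [fmod, f]
  convert h using 2 with n
  simp only [Function.comp_apply, map_sub, map_one, map_mul, map_pow, PowerSeries.map_X]
  ring

theorem fmod_eq_expand {k : ℕ} (hk : k ≠ 0) :
    fmod k = PowerSeries.expand k hk (pentagonalSeries (ZMod 2)) := by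
  have h := (WithPiTopology.hasProd_one_sub_X_pow (ZMod 2)).map
    (PowerSeries.expand k hk) (continuous_expand hk)
  refine (hasProd_fmod hk).unique ?_
  convert h using 2 with n
  simp [pow_mul]

theorem fmod_ne_zero {k : ℕ} (hk : k ≠ 0) : fmod k ≠ 0 := by
  intro h
  have := congrArg (coeff 0) (fmod_eq_expand hk ▸ h)
  have h0 : pentagonal 0 = 0 := by simp [pentagonal_def]
  have h1 := coeff_pentagonalSeries_pentagonal (ZMod 2) 0
  rw [h0] at h1
  simp [coeff_expand, h1] at this

theorem two_eq_zero : (2 : PowerSeries (ZMod 2)) = 0 := by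
  rw [show (2 : PowerSeries (ZMod 2)) = C 2 from (map_ofNat C 2).symm,
    show (2 : ZMod 2) = 0 from rfl, map_zero]

theorem fmod_two_mul {k : ℕ} (hk : k ≠ 0) : fmod (2 * k) = fmod k ^ 2 := by
  have h := (hasProd_fmod hk).mul (hasProd_fmod hk)
  rw [sq]
  refine (hasProd_fmod (by omega)).unique ?_
  convert h using 2 with n
  rw [mul_assoc, pow_mul']
  linear_combination (X ^ (k * (n + 1)) - (X ^ (k * (n + 1))) ^ 2) * two_eq_zero

/-- Indexing by all positive integers lets products with different `k` be compared factor by factor.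
-/
theorem hasProd_fmod_ite {k : ℕ} (hk : k ≠ 0) :
    HasProd (fun n : ℕ => (if k ∣ n + 1 then 1 - X ^ (n + 1) else 1 : PowerSeries (ZMod 2)))
      (fmod k) := by
  have hinj : Function.Injective fun n : ℕ => k * (n + 1) - 1 := by
    intro a b h
    have ha : 0 < k * (a + 1) := by positivity
    have hb : 0 < k * (b + 1) := by positivity
    have : k * (a + 1) = k * (b + 1) := by simp only at h; omega
    simpa [hk] using this
  rw [← hinj.hasProd_iff]
  · convert hasProd_fmod hk using 2 with n
    have ha : 0 < k * (n + 1) := by positivity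
    simp [Nat.sub_add_cancel ha]
  · intro n hn
    rw [if_neg]
    rintro ⟨c, hc⟩
    refine hn ⟨c - 1, ?_⟩
    have : c ≠ 0 := by rintro rfl; simp at hc
    simp [Nat.sub_add_cancel (Nat.one_le_iff_ne_zero.mpr this), ← hc]

/-! ### The generating function of `a 2 7` and its odd part -/

/-- The generating function of `a 2 7` modulo `2`. -/
noncomputable def genA : PowerSeries (ZMod 2) :=
  PowerSeries.mk fun n => (a 2 7 n : ZMod 2)

theorem genA_eq_genFun : genA = Nat.Partition.genFun
    (fun i c => if c ≤ 1 ∧ ¬ 2 ∣ i ∧ ¬ 7 ∣ i then (1 : ZMod 2) else 0) := by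
  ext n
  rw [genA, coeff_mk, Nat.Partition.coeff_genFun, a, Finset.card_filter, Nat.Partition.distincts,
    Finset.sum_filter]
  push_cast
  refine Finset.sum_congr rfl fun π _ => ?_
  rw [Finsupp.prod, Finset.prod_ite_zero]
  simp only [Multiset.toFinsupp_support, Multiset.mem_toFinset, Multiset.toFinsupp_apply,
    Finset.prod_const_one, ← ite_and]
  refine if_congr (Multiset.nodup_iff_count_le_one.and Iff.rfl |>.trans
    ⟨fun h i hi => ⟨h.1 i, h.2 i hi⟩, fun h => ⟨fun i => ?_, fun i hi => (h i hi).2⟩⟩)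
    rfl rfl
  by_cases hi : i ∈ π.parts
  · exact (h i hi).1
  · simp [Multiset.count_eq_zero_of_notMem hi]

theorem hasProd_genA :
    HasProd (fun n : ℕ =>
      (if ¬ 2 ∣ n + 1 ∧ ¬ 7 ∣ n + 1 then 1 - X ^ (n + 1) else 1 : PowerSeries (ZMod 2))) genA := by
  rw [genA_eq_genFun]
  refine (Nat.Partition.hasProd_genFun _).congr_fun fun n => ?_
  rw [tsum_eq_single 0]
  · by_cases h : ¬ 2 ∣ n + 1 ∧ ¬ 7 ∣ n + 1
    · simp only [h, zero_add, mul_one, le_refl, not_false_eq_true, and_self, if_true,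
        one_smul]
      linear_combination - X ^ (n + 1) * two_eq_zero
    · rw [if_neg h, if_neg fun h' => h h'.2, zero_smul, add_zero]
  · intro j hj
    rw [if_neg (by omega), zero_smul]

/-- Inclusion-exclusion on divisibility by 2 and 7 gives an identity with `fmod 14`, which is the
square of `fmod 7`; one factor `fmod 7` cancels. -/
theorem genA_mul_fmod_two : genA * fmod 2 = fmod 1 * fmod 7 := by
  have h : genA * fmod 2 * fmod 7 = fmod 1 * fmod 14 := by
    refine ((hasProd_genA.mul (hasProd_fmod_ite two_ne_zero)).mul
      (hasProd_fmod_ite (k := 7) (by norm_num))).unique ?_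
    convert (hasProd_fmod_ite one_ne_zero).mul (hasProd_fmod_ite (k := 14) (by norm_num))
      using 2 with n
    have h14 : 14 ∣ n + 1 ↔ 2 ∣ n + 1 ∧ 7 ∣ n + 1 := by omega
    by_cases h2 : 2 ∣ n + 1 <;> by_cases h7 : 7 ∣ n + 1 <;> simp [h14, h2, h7]
  rw [show 14 = 2 * 7 from rfl, fmod_two_mul (k := 7) (by norm_num), sq, ← mul_assoc] at h
  exact mul_right_cancel₀ (fmod_ne_zero (by norm_num)) h

theorem coeff_mul_expand_two (A B : PowerSeries (ZMod 2)) :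
    (PowerSeries.mk fun n => coeff (2 * n + 1) (A * PowerSeries.expand 2 two_ne_zero B)) =
      (PowerSeries.mk fun n => coeff (2 * n + 1) A) * B := by
  ext n
  rw [coeff_mk, coeff_mul, coeff_mul]
  symm
  refine Finset.sum_of_injOn (fun ij => (2 * ij.1 + 1, 2 * ij.2)) ?_ ?_ ?_ ?_
  · rintro ⟨i, j⟩ - ⟨k, l⟩ - h
    simp only [Prod.mk.injEq] at h ⊢
    omega
  · rintro ⟨i, j⟩ h
    simp only [Finset.mem_coe,
      Finset.HasAntidiagonal.mem_antidiagonal] at h ⊢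
    omega
  · rintro ⟨i, j⟩ h h'
    rw [coeff_expand_of_not_dvd, mul_zero]
    rintro ⟨l, rfl⟩
    replace h : i + 2 * l = 2 * n + 1 := by simpa using h
    refine h' ⟨(n - l, l), ?_, ?_⟩
    · simp only [Finset.mem_coe, Finset.HasAntidiagonal.mem_antidiagonal]
      omega
    · exact Prod.ext (by change 2 * (n - l) + 1 = i; omega) rfl
  · rintro ⟨i, j⟩ -
    simp [coeff_expand_mul]

/-! ### Coefficients as numbers of representations -/

theorem coprime_six_iff (x : ℕ) : x.Coprime 6 ↔ x % 2 = 1 ∧ x % 3 ≠ 0 := by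
  rw [show 6 = 2 * 3 from rfl, Nat.coprime_mul_iff_right, Nat.coprime_comm,
    Nat.Prime.coprime_iff_not_dvd Nat.prime_two, Nat.coprime_comm,
    Nat.Prime.coprime_iff_not_dvd Nat.prime_three]
  omega

theorem coprime_six_iff_exists (x : ℕ) :
    x.Coprime 6 ↔ ∃ k : ℤ, x = (6 * k - 1).natAbs := by
  rw [coprime_six_iff]
  constructor
  · rintro ⟨h2, h3⟩
    have hm : x % 6 = 1 ∨ x % 6 = 5 := by omega
    rcases hm with hm | hm
    · exact ⟨-(x / 6 : ℕ), by omega⟩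
    · exact ⟨(x / 6 + 1 : ℕ), by omega⟩
  · rintro ⟨k, rfl⟩
    omega

theorem mem_range_pentagonal_iff (n : ℕ) :
    n ∈ Set.range pentagonal ↔ ∃ x : ℕ, x.Coprime 6 ∧ x ^ 2 = 24 * n + 1 := by
  simp only [coprime_six_iff_exists]
  constructor
  · rintro ⟨k, rfl⟩
    refine ⟨_, ⟨k, rfl⟩, ?_⟩
    zify
    rw [sq_abs]
    linear_combination -12 * two_mul_natCast_pentagonal k
  · rintro ⟨x, ⟨k, rfl⟩, h⟩
    refine ⟨k, ?_⟩
    zify at h ⊢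
    rw [sq_abs] at h
    linarith [two_mul_natCast_pentagonal k]

theorem exists_sq_eq_of_coprime_six {x : ℕ} (hx : x.Coprime 6) : ∃ k, x ^ 2 = 24 * k + 1 := by
  obtain ⟨k, rfl⟩ := (coprime_six_iff_exists x).mp hx
  refine ⟨pentagonal k, ?_⟩
  zify
  rw [sq_abs]
  linear_combination -12 * two_mul_natCast_pentagonal k

-- Completing the square: `n = k * g` with `g` pentagonal exactly when `24 * g + 1` is a square
-- `x²`; the signs of the pentagonal series are 1 modulo 2.
open Classical in
theorem coeff_fmod {k : ℕ} (hk : k ≠ 0) (n : ℕ) :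
    coeff n (fmod k) = if ∃ x : ℕ, x.Coprime 6 ∧ k * x ^ 2 = 24 * n + k then 1 else 0 := by
  rw [fmod_eq_expand hk, coeff_expand]
  split_ifs with h1 h2 h2
  · obtain ⟨m, rfl⟩ := h1
    obtain ⟨x, hx, h⟩ := h2
    have h' : x ^ 2 = 24 * m + 1 := by
      apply Nat.eq_of_mul_eq_mul_left (Nat.pos_of_ne_zero hk)
      linarith
    rw [Nat.mul_div_cancel_left _ (Nat.pos_of_ne_zero hk)]
    obtain ⟨l, rfl⟩ := (mem_range_pentagonal_iff m).mpr ⟨x, hx, h'⟩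
    rw [coeff_pentagonalSeries_pentagonal]
    rcases Int.even_or_odd l with hl | hl
    · simp [Int.negOnePow_even _ hl]
    · simp [Int.negOnePow_odd _ hl]
  · obtain ⟨m, rfl⟩ := h1
    rw [Nat.mul_div_cancel_left _ (Nat.pos_of_ne_zero hk)]
    refine coeff_pentagonalSeries_eq_zero _ fun hm => h2 ?_
    obtain ⟨x, hx, h⟩ := (mem_range_pentagonal_iff m).mp hm
    exact ⟨x, hx, by rw [h]; ring⟩
  · obtain ⟨x, hx, h⟩ := h2
    obtain ⟨m, hm⟩ := exists_sq_eq_of_coprime_six hx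
    refine absurd ⟨m, ?_⟩ h1
    rw [hm] at h
    linarith
  · rfl

/-- The representations of `N` by the form `a x² + b y²` with `x` and `y` positive and prime
to `6`. -/
def reps (a b N : ℕ) : Finset (ℕ × ℕ) :=
  (Finset.range (N + 1) ×ˢ Finset.range (N + 1)).filter fun z =>
    z.1.Coprime 6 ∧ z.2.Coprime 6 ∧ a * z.1 ^ 2 + b * z.2 ^ 2 = N

theorem mem_reps {a b N : ℕ} (ha : a ≠ 0) (hb : b ≠ 0) {z : ℕ × ℕ} :
    z ∈ reps a b N ↔ z.1.Coprime 6 ∧ z.2.Coprime 6 ∧ a * z.1 ^ 2 + b * z.2 ^ 2 = N := by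
  rw [reps, Finset.mem_filter, and_iff_right_of_imp]
  rintro ⟨-, -, h⟩
  have h1 : z.1 ≤ a * z.1 ^ 2 :=
    (Nat.le_self_pow two_ne_zero _).trans (Nat.le_mul_of_pos_left _ (Nat.pos_of_ne_zero ha))
  have h2 : z.2 ≤ b * z.2 ^ 2 :=
    (Nat.le_self_pow two_ne_zero _).trans (Nat.le_mul_of_pos_left _ (Nat.pos_of_ne_zero hb))
  simp only [Finset.mem_product, Finset.mem_range]
  omega

theorem coeff_fmod_mul_fmod {a b : ℕ} (ha : a ≠ 0) (hb : b ≠ 0) (n : ℕ) :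
    coeff n (fmod a * fmod b) = ((reps a b (24 * n + a + b)).card : ZMod 2) := by
  classical
  simp only [coeff_mul, coeff_fmod ha, coeff_fmod hb, mul_ite, mul_one, mul_zero, ← ite_and]
  rw [Finset.sum_boole]
  congr 1
  symm
  refine Finset.card_bij (fun z _ => ((a * z.1 ^ 2 - a) / 24, (b * z.2 ^ 2 - b) / 24)) ?_ ?_ ?_
  · rintro ⟨x, y⟩ h
    obtain ⟨hx, hy, h⟩ := (mem_reps ha hb).mp h
    obtain ⟨k, hk⟩ := exists_sq_eq_of_coprime_six hx
    obtain ⟨l, hl⟩ := exists_sq_eq_of_coprime_six hy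
    have e1 : a * x ^ 2 = 24 * (a * k) + a := by rw [hk]; ring
    have e2 : b * y ^ 2 = 24 * (b * l) + b := by rw [hl]; ring
    simp only [Finset.mem_filter, Finset.HasAntidiagonal.mem_antidiagonal]
    simp only at h hx hy
    refine ⟨by omega, ⟨y, hy, by omega⟩, ⟨x, hx, by omega⟩⟩
  · rintro ⟨x, y⟩ h ⟨x', y'⟩ h' hz
    obtain ⟨hx, hy, -⟩ := (mem_reps ha hb).mp h
    obtain ⟨hx', hy', -⟩ := (mem_reps ha hb).mp h'
    have key : ∀ {c u v : ℕ}, c ≠ 0 → u.Coprime 6 → v.Coprime 6 →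
        (c * u ^ 2 - c) / 24 = (c * v ^ 2 - c) / 24 → u = v := by
      intro c u v hc hu hv huv
      obtain ⟨k, hk⟩ := exists_sq_eq_of_coprime_six hu
      obtain ⟨l, hl⟩ := exists_sq_eq_of_coprime_six hv
      have e1 : c * u ^ 2 = 24 * (c * k) + c := by rw [hk]; ring
      have e2 : c * v ^ 2 = 24 * (c * l) + c := by rw [hl]; ring
      have : c * u ^ 2 = c * v ^ 2 := by omega
      exact Nat.pow_left_injective two_ne_zero
        (Nat.eq_of_mul_eq_mul_left (Nat.pos_of_ne_zero hc) this)
    simp only [Prod.mk.injEq] at hz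
    exact Prod.ext (key ha hx hx' hz.1) (key hb hy hy' hz.2)
  · rintro ⟨i, j⟩ h
    simp only [Finset.mem_filter, Finset.HasAntidiagonal.mem_antidiagonal] at h
    obtain ⟨hij, ⟨y, hy, hyj⟩, ⟨x, hx, hxi⟩⟩ := h
    refine ⟨(x, y), (mem_reps ha hb).mpr ⟨hx, hy, by simp only; omega⟩, ?_⟩
    simp only [Prod.mk.injEq]
    omega

/-! ### The form `x² + 7y²` and the field `ℚ(√-7)` -/

theorem mem_reps_one_seven {N : ℕ} (hN : N % 3 = 2) {z : ℕ × ℕ} :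
    z ∈ reps 1 7 N ↔ z.1 % 2 = 1 ∧ z.2 % 2 = 1 ∧ z.1 ^ 2 + 7 * z.2 ^ 2 = N := by
  rw [mem_reps one_ne_zero (by norm_num), coprime_six_iff, coprime_six_iff, one_mul]
  refine ⟨fun h => ⟨h.1.1, h.2.1.1, h.2.2⟩, fun h => ⟨⟨h.1, ?_⟩, ⟨h.2.1, ?_⟩, h.2.2⟩⟩
  all_goals
    intro h0
    have h3 := h.2.2
    have e1 : z.1 ^ 2 % 3 = (z.1 % 3) ^ 2 % 3 := Nat.pow_mod _ _ _
    have e2 : z.2 ^ 2 % 3 = (z.2 % 3) ^ 2 % 3 := Nat.pow_mod _ _ _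
    have l1 : z.1 % 3 = 0 ∨ z.1 % 3 = 1 ∨ z.1 % 3 = 2 := by omega
    have l2 : z.2 % 3 = 0 ∨ z.2 % 3 = 1 ∨ z.2 % 3 = 2 := by omega
    rcases l1 with l1 | l1 | l1 <;> rcases l2 with l2 | l2 | l2 <;> rw [l1] at e1 <;>
      rw [l2] at e2 <;> omega

/-- The number `x` with its sign chosen, if possible, such that adding `3 y` gives a multiple
of `q`. -/
def signed (q : ℤ) (z : ℕ × ℕ) : ℤ :=
  if ((z.1 : ℤ) + 3 * z.2) % q = 0 then z.1 else -z.1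

theorem signed_sq (q : ℤ) (z : ℕ × ℕ) : signed q z ^ 2 = (z.1 : ℤ) ^ 2 := by
  unfold signed
  split_ifs <;> ring

/-- Modulo 16 the form is `(x + 3y)(x - 3y)`. The factors sum to `2x` with `x` odd, so one is not
divisible by 4 and the other absorbs a factor 8. In `ZMod 32`, oddness of `x` reads `16 * x = 16`.
-/
theorem add_or_sub_mod_eight {x y : ℤ} (hx : x % 2 = 1) (h : (x ^ 2 + 7 * y ^ 2) % 32 = 0) :
    (x + 3 * y) % 8 = 0 ∨ (-x + 3 * y) % 8 = 0 := by
  have key : ∀ x y : ZMod 32, 16 * x = 16 → x ^ 2 + 7 * y ^ 2 = 0 →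
    4 * (x + 3 * y) = 0 ∨ 4 * (-x + 3 * y) = 0 := by decide
  have h1 : ((x ^ 2 + 7 * y ^ 2 : ℤ) : ZMod 32) = 0 :=
    (ZMod.intCast_zmod_eq_zero_iff_dvd _ 32).mpr (by push_cast; omega)
  have h2 : ((16 * x - 16 : ℤ) : ZMod 32) = 0 :=
    (ZMod.intCast_zmod_eq_zero_iff_dvd _ 32).mpr (by push_cast; omega)
  push_cast at h1 h2
  refine (key x y (sub_eq_zero.mp h2) h1).imp (fun h => ?_) (fun h => ?_)
  · have := (ZMod.intCast_zmod_eq_zero_iff_dvd (4 * (x + 3 * y)) 32).mp (by push_cast; exact h)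
    omega
  · have := (ZMod.intCast_zmod_eq_zero_iff_dvd (4 * (-x + 3 * y)) 32).mp (by push_cast; exact h)
    omega

/-- Here `y` is odd too, so `x² - 9y² = (x² + 7y²) - 16y²` is divisible by 32, and one factor
absorbs 16. -/
theorem add_or_sub_mod_sixteen {x y : ℤ} (hx : x % 2 = 1)
    (h : (x ^ 2 + 7 * y ^ 2) % 32 = 16) :
    (x + 3 * y) % 16 = 0 ∨ (-x + 3 * y) % 16 = 0 := by
  have key : ∀ x y : ZMod 32, 16 * x = 16 → x ^ 2 + 7 * y ^ 2 = 16 →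
    2 * (x + 3 * y) = 0 ∨ 2 * (-x + 3 * y) = 0 := by decide
  have h1 : ((x ^ 2 + 7 * y ^ 2 - 16 : ℤ) : ZMod 32) = 0 :=
    (ZMod.intCast_zmod_eq_zero_iff_dvd _ 32).mpr (by push_cast; omega)
  have h2 : ((16 * x - 16 : ℤ) : ZMod 32) = 0 :=
    (ZMod.intCast_zmod_eq_zero_iff_dvd _ 32).mpr (by push_cast; omega)
  push_cast at h1 h2
  refine (key x y (sub_eq_zero.mp h2) (sub_eq_zero.mp h1)).imp (fun h => ?_) (fun h => ?_)
  · have := (ZMod.intCast_zmod_eq_zero_iff_dvd (2 * (x + 3 * y)) 32).mp (by push_cast; exact h)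
    omega
  · have := (ZMod.intCast_zmod_eq_zero_iff_dvd (2 * (-x + 3 * y)) 32).mp (by push_cast; exact h)
    omega

/-- Multiplication of `(x + y √-7) / 2` by the quotient of the two primes above `2` in
`ℚ(√-7)`. -/
def lower (z : ℕ × ℕ) : ℕ × ℕ :=
  (((7 * (z.2 : ℤ) - 3 * signed 8 z) / 8).natAbs, ((signed 8 z + 3 * z.2) / 8).natAbs)

/-- The inverse of `lower` on pairs of odd numbers. -/
def raise (z : ℕ × ℕ) : ℕ × ℕ :=
  -- For odd entries this choice of sign makes both halves odd.
  if ((z.1 : ℤ) - z.2) % 4 = 0 then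
    (((3 * z.1 + 7 * z.2 : ℤ) / 2).natAbs, ((z.1 - 3 * z.2 : ℤ) / 2).natAbs)
  else (((3 * z.1 - 7 * z.2 : ℤ) / 2).natAbs, ((z.1 + 3 * z.2 : ℤ) / 2).natAbs)

theorem card_reps_four_mul {M : ℕ} (h8 : M % 8 = 0) (h3 : M % 3 = 2) :
    (reps 1 7 (4 * M)).card = (reps 1 7 M).card := by
  have sg : ∀ z ∈ reps 1 7 (4 * M), z.1 % 2 = 1 ∧ z.2 % 2 = 1 ∧
      (((z.1 : ℤ) + 3 * z.2) % 8 = 0 ∨ (-(z.1 : ℤ) + 3 * z.2) % 8 = 0) := by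
    intro z hz
    obtain ⟨h1, h2, h⟩ := (mem_reps_one_seven (by omega)).mp hz
    zify at h
    exact ⟨h1, h2, add_or_sub_mod_eight (by omega) (by omega)⟩
  have low : ∀ z ∈ reps 1 7 (4 * M), lower z ∈ reps 1 7 M := by
    intro z hz
    obtain ⟨h1, h2, hs⟩ := sg z hz
    have h := ((mem_reps_one_seven (by omega)).mp hz).2.2
    zify at h
    rw [← signed_sq 8 z] at h
    have h8' : (signed 8 z + 3 * z.2) % 8 = 0 := by unfold signed; split_ifs <;> omega
    obtain ⟨V, hV⟩ : ∃ V : ℤ, signed 8 z + 3 * z.2 = 8 * V :=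
      ⟨(signed 8 z + 3 * z.2) / 8, by omega⟩
    have hX : signed 8 z = 8 * V - 3 * z.2 := by omega
    have hU : 7 * (z.2 : ℤ) - 3 * signed 8 z = 8 * (2 * z.2 - 3 * V) := by omega
    have hl : lower z = ((2 * (z.2 : ℤ) - 3 * V).natAbs, V.natAbs) := by
      rw [lower, hU, hV, Int.mul_ediv_cancel_left _ (by norm_num),
        Int.mul_ediv_cancel_left _ (by norm_num)]
    have hM : (2 * (z.2 : ℤ) - 3 * V) ^ 2 + 7 * V ^ 2 = M := by
      rw [hX] at h
      linarith
    -- If `V` were even, then `M / 4` would be odd because `z.2` is odd, against `8 ∣ M`.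
    have hodd : V % 2 = 1 := by
      by_contra hc
      obtain ⟨W, rfl⟩ : ∃ W, V = 2 * W := ⟨V / 2, by omega⟩
      obtain ⟨y, hy⟩ : ∃ y, (z.2 : ℤ) = 2 * y + 1 := ⟨z.2 / 2, by omega⟩
      rw [hy] at hM
      obtain ⟨m, rfl⟩ : ∃ m, M = 8 * m := ⟨M / 8, by omega⟩
      push_cast at hM
      have : 2 * (8 * W ^ 2 - 6 * y * W - 3 * W + 2 * y ^ 2 + 2 * y) + 1 = 2 * (m : ℤ) := by
        linarith
      omega
    rw [hl, mem_reps_one_seven h3]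
    refine ⟨by simp only; omega, by simp only; omega, ?_⟩
    zify
    rw [sq_abs, sq_abs]
    exact hM
  refine Finset.card_bij' (fun z _ => lower z) (fun z _ => raise z) low ?_ ?_ ?_
  · intro z hz
    obtain ⟨h1, h2, h⟩ := (mem_reps_one_seven h3).mp hz
    rw [mem_reps_one_seven (by omega)]
    obtain ⟨u, v⟩ := z
    simp only at h1 h2 h
    unfold raise
    split_ifs with hc
    · simp only at hc
      obtain ⟨Y, hY⟩ : ∃ Y : ℤ, (u - 3 * v : ℤ) = 2 * Y := ⟨(u - 3 * v) / 2, by omega⟩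
      refine ⟨by simp only; omega, by simp only; omega, ?_⟩
      have hX : (3 * u + 7 * v : ℤ) = 2 * (3 * Y + 8 * v) := by omega
      simp only
      rw [hX, hY, Int.mul_ediv_cancel_left _ (by norm_num),
        Int.mul_ediv_cancel_left _ (by norm_num)]
      zify at h ⊢
      rw [sq_abs, sq_abs, ← h, show (u : ℤ) = 2 * Y + 3 * v by omega]
      ring
    · simp only at hc
      obtain ⟨Y, hY⟩ : ∃ Y : ℤ, (u + 3 * v : ℤ) = 2 * Y := ⟨(u + 3 * v) / 2, by omega⟩
      refine ⟨by simp only; omega, by simp only; omega, ?_⟩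
      have hX : (3 * u - 7 * v : ℤ) = 2 * (3 * Y - 8 * v) := by omega
      simp only
      rw [hX, hY, Int.mul_ediv_cancel_left _ (by norm_num),
        Int.mul_ediv_cancel_left _ (by norm_num)]
      zify at h ⊢
      rw [sq_abs, sq_abs, ← h, show (u : ℤ) = 2 * Y - 3 * v by omega]
      ring
  · intro z hz
    obtain ⟨h1, h2, hs⟩ := sg z hz
    obtain ⟨h1', h2', -⟩ := (mem_reps_one_seven h3).mp (low z hz)
    obtain ⟨x, y⟩ := z
    revert h1' h2'
    unfold raise lower signed
    simp only at h1 h2 hs ⊢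
    split_ifs <;> simp only [Prod.mk.injEq] <;> intro h1' h2' <;> omega
  · intro z hz
    obtain ⟨h1, h2, h⟩ := (mem_reps_one_seven h3).mp hz
    obtain ⟨u, v⟩ := z
    unfold lower signed raise
    simp only at h1 h2 ⊢
    split_ifs <;> simp only [Prod.mk.injEq] <;> omega

/-- Conjugation of `s + t √-7`, transported to `x = -3 s - 7 t`, `y = s - 3 t`. -/
def conjugate (z : ℕ × ℕ) : ℕ × ℕ :=
  ((3 * ((7 * (z.2 : ℤ) - 3 * signed 16 z) / 16) + 7 * ((signed 16 z + 3 * z.2) / 16)).natAbs,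
    ((7 * (z.2 : ℤ) - 3 * signed 16 z) / 16 - 3 * ((signed 16 z + 3 * z.2) / 16)).natAbs)

theorem sq_mod_three (x : ℤ) : x ^ 2 % 3 = 0 ∨ x ^ 2 % 3 = 1 := by
  have h : x % 3 = 0 ∨ x % 3 = 1 ∨ x % 3 = 2 := by omega
  rcases h with h | h | h <;> simp [pow_two, Int.mul_emod, h]

/-- Each representation comes from some `s² + 7t² = m`, and `t ↦ -t` pairs them off. A fixed point
needs `s = 0` or `t = 0`, which `m ≡ 2` modulo 3 excludes. -/
theorem card_reps_sixteen_mul {m : ℕ} (h2 : m % 2 = 1) (h3 : m % 3 = 2) :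
    ((reps 1 7 (16 * m)).card : ZMod 2) = 0 := by
  have par : ∀ z ∈ reps 1 7 (16 * m), ∃ s t : ℤ, signed 16 z = -3 * s - 7 * t ∧
      (z.2 : ℤ) = s - 3 * t ∧ s ^ 2 + 7 * t ^ 2 = m ∧
      conjugate z = ((3 * s - 7 * t).natAbs, (s + 3 * t).natAbs) := by
    intro z hz
    obtain ⟨h1, -, h⟩ := (mem_reps_one_seven (by omega)).mp hz
    zify at h
    have hs := add_or_sub_mod_sixteen (x := z.1) (y := z.2) (by omega) (by omega)
    have h16 : (signed 16 z + 3 * z.2) % 16 = 0 := by unfold signed; split_ifs <;> omega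
    rw [← signed_sq 16 z] at h
    obtain ⟨t, ht⟩ : ∃ t : ℤ, signed 16 z + 3 * z.2 = 16 * t :=
      ⟨(signed 16 z + 3 * z.2) / 16, by omega⟩
    have hs' : 7 * (z.2 : ℤ) - 3 * signed 16 z = 16 * (z.2 - 3 * t) := by omega
    have hX : signed 16 z = 16 * t - 3 * z.2 := by omega
    refine ⟨z.2 - 3 * t, -t, by omega, by omega, ?_, ?_⟩
    · rw [hX] at h
      linarith
    · rw [conjugate, ht, hs', Int.mul_ediv_cancel_left _ (by norm_num),
        Int.mul_ediv_cancel_left _ (by norm_num)]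
      exact Prod.ext (by simp only; omega) (by simp only; omega)
  have par2 : ∀ s t : ℤ, s ^ 2 + 7 * t ^ 2 = m → (s + t) % 2 = 1 := by
    intro s t h
    rcases Int.even_or_odd' s with ⟨i, rfl | rfl⟩ <;> rcases Int.even_or_odd' t with ⟨j, rfl | rfl⟩
    · have : 2 * (2 * i ^ 2 + 14 * j ^ 2) = (m : ℤ) := by linarith
      omega
    · omega
    · omega
    · have : 2 * (2 * i ^ 2 + 2 * i + 14 * j ^ 2 + 14 * j + 4) = (m : ℤ) := by linarith
      omega
  rw [Finset.card_eq_sum_ones, Nat.cast_sum]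
  refine Finset.sum_involution (fun z _ => conjugate z) (fun z _ => by decide) ?_ ?_ ?_
  · rintro z hz - hc
    obtain ⟨s, t, -, e2, e3, e4⟩ := par z hz
    rw [e4] at hc
    have hc2 := congrArg Prod.snd hc
    simp only at hc2
    -- A fixed point has `|s + 3t| = |s - 3t|`.
    have hst : s = 0 ∨ t = 0 := by omega
    have q1 := sq_mod_three s
    have q2 := sq_mod_three t
    rcases hst with rfl | rfl <;> omega
  · intro z hz
    obtain ⟨s, t, -, -, e3, e4⟩ := par z hz
    have := par2 s t e3
    rw [e4, mem_reps_one_seven (by omega)]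
    refine ⟨by simp only; omega, by simp only; omega, ?_⟩
    zify
    rw [sq_abs, sq_abs, ← e3]
    ring
  · intro z hz
    obtain ⟨s, t, e1, e2, e3, e4⟩ := par z hz
    have := par2 s t e3
    have h1 : (z.1 : ℤ) = (3 * s + 7 * t).natAbs := by
      unfold signed at e1
      split_ifs at e1 <;> omega
    rw [e4]
    unfold conjugate signed
    refine Prod.ext ?_ ?_ <;> simp only <;> split_ifs <;> omega

/-- Representations of `4 M` and of `M` by `x² + 7 y²` agree in number modulo `2`. -/
theorem card_reps_four_mul_zmod_two (k : ℕ) :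
    ((reps 1 7 (4 * (12 * k + 8))).card : ZMod 2) = (reps 1 7 (12 * k + 8)).card := by
  rcases Nat.even_or_odd' k with ⟨l, rfl | rfl⟩
  · rw [card_reps_four_mul (by omega) (by omega)]
  · rw [show 4 * (12 * (2 * l + 1) + 8) = 16 * (6 * l + 5) by ring,
      card_reps_sixteen_mul (by omega) (by omega)]
    suffices h : reps 1 7 (12 * (2 * l + 1) + 8) = ∅ by simp [h]
    refine Finset.eq_empty_of_forall_notMem fun z hz => ?_
    obtain ⟨h1, h2, h⟩ := (mem_reps one_ne_zero (by norm_num)).mp hz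
    obtain ⟨i, hi⟩ := exists_sq_eq_of_coprime_six h1
    obtain ⟨j, hj⟩ := exists_sq_eq_of_coprime_six h2
    -- Both squares are 1 modulo 24, so the form takes the value 8, not 20, modulo 24.
    omega

/-! ### From `x² + 7y²` to `x² + 14y²` -/

theorem reps_two_fourteen (N : ℕ) : reps 2 14 (2 * N) = reps 1 7 N := by
  ext z
  rw [mem_reps two_ne_zero (by norm_num), mem_reps one_ne_zero (by norm_num)]
  refine and_congr_right fun _ => and_congr_right fun _ => ?_
  omega

theorem mk_coeff_odd_genA :
    (PowerSeries.mk fun n => coeff (2 * n + 1) genA) = fmod 1 * fmod 14 := by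
  have h1 : fmod 2 = PowerSeries.expand 2 two_ne_zero (fmod 1) := by
    rw [fmod_eq_expand two_ne_zero, fmod_eq_expand one_ne_zero, expand_one_apply]
  have h3 := fmod_two_mul one_ne_zero
  rw [mul_one] at h3
  have h2 : (PowerSeries.mk fun n => coeff (2 * n + 1) (fmod 1 * fmod 7)) = fmod 2 * fmod 14 := by
    ext n
    rw [coeff_mk, coeff_fmod_mul_fmod one_ne_zero (by norm_num),
      coeff_fmod_mul_fmod two_ne_zero (by norm_num),
      show 24 * (2 * n + 1) + 1 + 7 = 4 * (12 * n + 8) by ring,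
      show 24 * n + 2 + 14 = 2 * (12 * n + 8) by ring, reps_two_fourteen,
      card_reps_four_mul_zmod_two]
  rw [← genA_mul_fmod_two, h1, coeff_mul_expand_two, ← h1, h3] at h2
  apply mul_right_cancel₀ (fmod_ne_zero one_ne_zero)
  rw [h2]
  ring

theorem a_odd_eq_card_reps (m : ℕ) :
    (a 2 7 (2 * m + 1) : ZMod 2) = (reps 1 14 (24 * m + 15)).card := by
  have h := congrArg (coeff m) mk_coeff_odd_genA
  rwa [coeff_mk, genA, coeff_mk, coeff_fmod_mul_fmod one_ne_zero (by norm_num), add_assoc] at h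

/-- The equation `x² + 14y² = 7N` forces `x = 7w`, leaving `2y² + 7w² = N`. -/
theorem card_reps_one_fourteen_seven_mul (N : ℕ) :
    (reps 1 14 (7 * N)).card = (reps 2 7 N).card := by
  symm
  refine Finset.card_bij (fun z _ => (7 * z.2, z.1)) ?_ ?_ ?_
  · intro z hz
    obtain ⟨h1, h2, h⟩ := (mem_reps two_ne_zero (by norm_num)).mp hz
    refine (mem_reps one_ne_zero (by norm_num)).mpr ⟨Nat.Coprime.mul_left (by norm_num) h2, h1, ?_⟩
    rw [← h]
    ring
  · rintro ⟨x, y⟩ - ⟨x', y'⟩ - h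
    simp only [Prod.mk.injEq] at h ⊢
    omega
  · rintro ⟨x, y⟩ hz
    obtain ⟨h1, h2, h⟩ := (mem_reps one_ne_zero (by norm_num)).mp hz
    have h7 : 7 ∣ x := by
      apply Nat.Prime.dvd_of_dvd_pow (n := 2) (by norm_num)
      simp only at h
      omega
    obtain ⟨w, rfl⟩ := h7
    refine ⟨(y, w), (mem_reps two_ne_zero (by norm_num)).mpr
      ⟨h2, h1.coprime_mul_left, ?_⟩, rfl⟩
    simp only [mul_pow] at h ⊢
    omega

/-! ### Descent at the inert prime `p` -/

section Inert

variable {p : ℕ} [Fact p.Prime]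

theorem dvd_of_mem_reps (hleg : legendreSym p (-14) = -1) {N : ℕ} (hN : p ∣ N) {z : ℕ × ℕ}
    (hz : z ∈ reps 1 14 N) : p ∣ z.1 ∧ p ∣ z.2 := by
  have h := ((mem_reps one_ne_zero (by norm_num)).mp hz).2.2
  have := legendreSym.prime_dvd_of_eq_neg_one hleg (x := z.1) (y := z.2) (by
    have : ((z.1 : ℤ) ^ 2 - -14 * (z.2 : ℤ) ^ 2) = (N : ℤ) := by
      rw [← h]
      push_cast
      ring
    rw [this]
    exact_mod_cast hN)
  exact_mod_cast this

theorem coprime_six (hp : 7 < p) : p.Coprime 6 := by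
  have hpp : p.Prime := Fact.out
  rw [hpp.coprime_iff_not_dvd]
  intro h
  have := Nat.le_of_dvd (by norm_num) h
  omega

theorem card_reps_sq_mul (hp : 7 < p) (hleg : legendreSym p (-14) = -1) (N : ℕ) :
    (reps 1 14 (p ^ 2 * N)).card = (reps 1 14 N).card := by
  have hpp : p.Prime := Fact.out
  have h6 := coprime_six hp
  symm
  refine Finset.card_bij (fun z _ => (p * z.1, p * z.2)) ?_ ?_ ?_
  · intro z hz
    obtain ⟨h1, h2, h⟩ := (mem_reps one_ne_zero (by norm_num)).mp hz
    refine (mem_reps one_ne_zero (by norm_num)).mpr ⟨h6.mul_left h1, h6.mul_left h2, ?_⟩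
    rw [← h]
    ring
  · rintro ⟨x, y⟩ - ⟨x', y'⟩ - h
    simpa [hpp.ne_zero] using h
  · rintro ⟨x, y⟩ hz
    obtain ⟨⟨x, rfl⟩, ⟨y, rfl⟩⟩ :=
      dvd_of_mem_reps hleg (Dvd.dvd.mul_right (dvd_pow_self p two_ne_zero) N) hz
    obtain ⟨h1, h2, h⟩ := (mem_reps one_ne_zero (by norm_num)).mp hz
    refine ⟨(x, y), (mem_reps one_ne_zero (by norm_num)).mpr
      ⟨h1.coprime_mul_left, h2.coprime_mul_left, ?_⟩, rfl⟩
    apply Nat.eq_of_mul_eq_mul_left (pow_pos hpp.pos 2)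
    rw [← h]
    ring

theorem card_reps_pow_mul (hp : 7 < p) (hleg : legendreSym p (-14) = -1) (α N : ℕ) :
    (reps 1 14 (p ^ (2 * α) * N)).card = (reps 1 14 N).card := by
  induction α with
  | zero => simp
  | succ α ih =>
    rw [show p ^ (2 * (α + 1)) * N = p ^ 2 * (p ^ (2 * α) * N) by ring,
      card_reps_sq_mul hp hleg, ih]

theorem reps_eq_empty (hleg : legendreSym p (-14) = -1) {N : ℕ} (hN : ¬ p ∣ N) :
    reps 1 14 (p * N) = ∅ := by
  have hpp : p.Prime := Fact.out
  refine Finset.eq_empty_of_forall_notMem fun ⟨x, y⟩ hz => hN ?_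
  obtain ⟨⟨x, rfl⟩, ⟨y, rfl⟩⟩ := dvd_of_mem_reps hleg (dvd_mul_right p N) hz
  have h := ((mem_reps one_ne_zero (by norm_num)).mp hz).2.2
  refine ⟨x ^ 2 + 14 * y ^ 2, ?_⟩
  apply Nat.eq_of_mul_eq_mul_left hpp.pos
  rw [← h]
  ring

theorem exists_pow_two_mul_eq (hp : 7 < p) (α : ℕ) : ∃ k, p ^ (2 * α) = 24 * k + 1 := by
  rw [mul_comm, pow_mul]
  exact exists_sq_eq_of_coprime_six ((coprime_six hp).pow_left α)

theorem a_eq_zero_of_not_dvd (hp : 7 < p) (hleg : legendreSym p (-14) = -1) {α m M n : ℕ}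
    (hn : n = 2 * m + 1) (hm : 24 * m + 15 = p ^ (2 * α) * (p * M)) (hM : ¬ p ∣ M) :
    a 2 7 n ≡ 0 [MOD 2] := by
  rw [← ZMod.natCast_eq_natCast_iff, hn, a_odd_eq_card_reps, hm, card_reps_pow_mul hp hleg,
    reps_eq_empty hleg hM]
  simp

theorem a_eq_card_reps (hp : 7 < p) (hleg : legendreSym p (-14) = -1) {α m N n : ℕ}
    (hn : n = 2 * m + 1) (hm : 24 * m + 15 = p ^ (2 * α) * N) :
    (a 2 7 n : ZMod 2) = (reps 1 14 N).card := by
  rw [hn, a_odd_eq_card_reps, hm, card_reps_pow_mul hp hleg]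

theorem not_dvd_mul_add (hp : 7 < p) {c d j n : ℕ} (hc : c ∣ 168) (hj : 1 ≤ j)
    (hj' : j ≤ p - 1) : ¬ p ∣ c * (p * n + j) + d * p := by
  have hpp : p.Prime := Fact.out
  intro h
  have h1 : p ∣ c * j := by
    have h2 : c * (p * n + j) + d * p = c * j + p * (c * n + d) := by ring
    rw [h2] at h
    exact (Nat.dvd_add_left (dvd_mul_right _ _)).mp h
  rcases hpp.dvd_mul.mp h1 with h1 | h1
  · have h3 : p ∣ 2 ^ 3 * (3 * 7) := h1.trans hc
    rcases hpp.dvd_mul.mp h3 with h3 | h3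
    · have := Nat.le_of_dvd (by norm_num) (hpp.dvd_of_dvd_pow h3)
      omega
    · rcases hpp.dvd_mul.mp h3 with h3 | h3 <;>
      · have := Nat.le_of_dvd (by norm_num) h3
        omega
  · have := Nat.le_of_dvd (by omega) h1
    omega

end Inert

/-! ### The congruences -/

theorem seriesModEq_two_of_coeff {u : ℕ → ℕ} {b c : ℕ} (hb : b ≠ 0) (hc : c ≠ 0)
    (h : ∀ n, (u n : ZMod 2) = (reps b c (24 * n + b + c)).card) :
    SeriesModEq 2 (PowerSeries.mk fun n => (u n : ℤ)) (f b * f c) := by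
  intro n
  rw [coeff_mk]
  have h' := h n
  rw [← coeff_fmod_mul_fmod hb hc, fmod, fmod, ← map_mul, coeff_map] at h'
  refine (ZMod.intCast_eq_intCast_iff _ _ 2).mp ?_
  simpa using h'

end RegularDistinct

theorem theorem1p4 (p : ℕ) [Fact p.Prime] (hp : 7 < p) (hleg : legendreSym p (-14) = -1)
    (α : ℕ) :
    RegularDistinct.SeriesModEq 2
      (PowerSeries.mk fun n =>
        (RegularDistinct.a 2 7 (2 * p ^ (2 * α) * n + (5 * p ^ (2 * α) - 1) / 4) : ℤ))
      (RegularDistinct.f 1 * RegularDistinct.f 14) ∧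
    (∀ n j : ℕ, 1 ≤ j → j ≤ p - 1 →
      RegularDistinct.a 2 7
        (2 * p ^ (2 * α + 1) * (p * n + j) + (5 * p ^ (2 * α + 2) - 1) / 4) ≡ 0 [MOD 2]) ∧
    RegularDistinct.SeriesModEq 2
      (PowerSeries.mk fun n =>
        (RegularDistinct.a 2 7 (14 * p ^ (2 * α) * n + (21 * p ^ (2 * α) - 1) / 4) : ℤ))
      (RegularDistinct.f 2 * RegularDistinct.f 7) ∧
    (∀ n j : ℕ, 1 ≤ j → j ≤ p - 1 →
      RegularDistinct.a 2 7
        (14 * p ^ (2 * α + 1) * (p * n + j) + (21 * p ^ (2 * α + 2) - 1) / 4) ≡ 0 [MOD 2]) := by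
  open RegularDistinct in
  obtain ⟨k, hk⟩ := exists_pow_two_mul_eq hp α
  obtain ⟨l, hl⟩ := exists_pow_two_mul_eq hp (α + 1)
  rw [mul_add, mul_one] at hl
  have hl' : p ^ (2 * α) * (p * p) = 24 * l + 1 := by rw [← hl]; ring
  refine ⟨?_, ?_, ?_, ?_⟩
  · refine seriesModEq_two_of_coeff one_ne_zero (by norm_num) fun n => ?_
    -- With `p ^ (2 * α) = 24 * k + 1`, the offset `(5 * p ^ (2 * α) - 1) / 4` is exactly `30 * k +
    -- 1`, and `24 * m + 15 = p ^ (2 * α) * (24 * n + 15)`.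
    refine a_eq_card_reps hp hleg (α := α) (m := p ^ (2 * α) * n + 15 * k) ?_ ?_
    · rw [mul_assoc]
      omega
    · zify at hk ⊢
      linear_combination -15 * hk
  · intro n j hj hj'
    refine a_eq_zero_of_not_dvd hp hleg (α := α) (m := p ^ (2 * α + 1) * (p * n + j) + 15 * l)
      (M := 24 * (p * n + j) + 15 * p) ?_ ?_ (not_dvd_mul_add hp (by norm_num) hj hj')
    · rw [mul_assoc]
      omega
    · zify at hl' ⊢
      linear_combination -15 * hl'
  · refine seriesModEq_two_of_coeff two_ne_zero (by norm_num) fun n => ?_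
    rw [show 24 * n + 2 + 7 = 24 * n + 9 by ring, ← card_reps_one_fourteen_seven_mul]
    -- The 2 comes from `63 = 24 * 2 + 15`, where `63 = 7 * 9`.
    refine a_eq_card_reps hp hleg (α := α) (m := 7 * (p ^ (2 * α) * n) + 63 * k + 2) ?_ ?_
    · rw [mul_assoc]
      omega
    · zify at hk ⊢
      linear_combination -63 * hk
  · intro n j hj hj'
    refine a_eq_zero_of_not_dvd hp hleg (α := α)
      (m := 7 * (p ^ (2 * α + 1) * (p * n + j)) + 63 * l + 2)
      (M := 168 * (p * n + j) + 63 * p) ?_ ?_ (not_dvd_mul_add hp dvd_rfl hj hj')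
    · rw [mul_assoc]
      omega
    · zify at hl' ⊢
      linear_combination -63 * hl'
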